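/- Let $(\Omega,\mathcal F)$ be a standard measurable space (isomorphic to a complete separable metric space with its Borel $\sigma$-algebra), let $T:\Omega\to\Omega$ be measurable, put $\mathcal I=\{A\in\mathcal F: T^{-1}A=A\}$, and let $f:\Omega\to\mathbb R$ be bounded and measurable. Call an $\mathcal I$-measurable function $g:\Omega\to\mathbb R$ a common conditional expectation of $f$ if $g=\mathbb E_P(f\mid\mathcal I)$ $P$-almost surely for every $T$-invariant probability $P$ on $(\Omega,\mathcal F)$. An upper probability is a set function $V:\mathcal F\to[0,1]$ with $V(\emptyset)=0$, $V(\Omega)=1$, $V(A)\le V(B)$ for $A\subset B$, for which there is a set $\Lambda$ of ($\sigma$-additive) probabilities on $\mathcal F$, compact in the topology of setwise convergence ($P_\alpha\to P$ iff $P_\alpha(A)\to P(A)$ for all $A\in\mathcal F$), such that $V(A)=\max_{P\in\Lambda}P(A)$ for all $A\in\mathcal F$; it is $T$-invariant if $V(T^{-1}A)=V(A)$ for all $A\in\mathcal F$. Then $f$ has a bounded common conditional expectation. Moreover, for every common conditional expectation $g_f$ of $f$ and every $T$-invariant upper probability $V$, the set $\{\omega\in\Omega:\lim_{n\to\infty}\frac1n\sum_{i=0}^{n-1}f(T^i\omega)=g_f(\omega)\}$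 belongs to $\mathcal F$ and $$V\Bigl(\Bigl\{\omega\in\Omega:\lim_{n\to\infty}\frac1n\sum_{i=0}^{n-1}f(T^i\omega)=g_f(\omega)\Bigr\}^c\Bigr)=0.$$ -/

import Mathlib

open MeasureTheory Filter Topology

/-- `B(Ω, 𝓕)`: bounded measurable real functions. -/
def IsBoundedMeasurable {Ω : Type*} [MeasurableSpace Ω] (f : Ω → ℝ) : Prop :=
  Measurable f ∧ ∃ C : ℝ, ∀ ω, |f ω| ≤ C

/-- The weak* topology on the set of all probabilities on `(Ω, 𝓕)`: the topology of convergence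
`P_α(A) → P(A)` for every measurable `A`, i.e. the one induced by
`P ↦ (P(A))_{A ∈ 𝓕}` from the product topology. It is not Mathlib's topology of convergence in
distribution (which needs a topology on `Ω`). -/
abbrev setwiseTopology (Ω : Type*) [MeasurableSpace Ω] : TopologicalSpace (ProbabilityMeasure Ω) :=
  TopologicalSpace.induced
    (fun (P : ProbabilityMeasure Ω) (A : {A : Set Ω // MeasurableSet A}) =>
      (P : Measure Ω).real A.1)
    Pi.topologicalSpace

/-- `V` is a capacity on `(Ω, 𝓕)`. Only the values of `V` on measurable sets are meaningful; on
those, the three conditions force `0 ≤ V A ≤ 1`. -/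
structure IsCapacity {Ω : Type*} [MeasurableSpace Ω] (V : Set Ω → ℝ) : Prop where
  empty : V ∅ = 0
  univ : V Set.univ = 1
  mono : ∀ A B : Set Ω, MeasurableSet A → MeasurableSet B → A ⊆ B → V A ≤ V B

/-- `V` is an upper probability: a capacity such that, for some weak*-compact set `Λ` of
probabilities, `V(A) = max_{P ∈ Λ} P(A)` (an attained maximum) for all measurable `A`. -/
def IsUpperProbability {Ω : Type*} [MeasurableSpace Ω] (V : Set Ω → ℝ) : Prop :=
  IsCapacity V ∧
    ∃ Λ : Set (ProbabilityMeasure Ω), @IsCompact _ (setwiseTopology Ω) Λ ∧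
      ∀ A : Set Ω, MeasurableSet A →
        IsGreatest ((fun P : ProbabilityMeasure Ω => (P : Measure Ω).real A) '' Λ) (V A)

/-- `V(T⁻¹A) = V(A)` for all measurable `A`. -/
def IsInvariantCapacity {Ω : Type*} [MeasurableSpace Ω] (T : Ω → Ω) (V : Set Ω → ℝ) : Prop :=
  ∀ A : Set Ω, MeasurableSet A → V (T ⁻¹' A) = V A

/-- `𝓜(T)`: the set of all `T`-invariant probabilities. -/
def invariantProbabilities {Ω : Type*} [MeasurableSpace Ω] (T : Ω → Ω) :
    Set (ProbabilityMeasure Ω) :=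
  {P | MeasurePreserving T (P : Measure Ω) (P : Measure Ω)}

/-- `g` is a common conditional expectation of `f` with respect to the sub-σ-algebra `𝓗` for the
set `Λ` of probabilities. -/
structure IsCommonCondExp {Ω : Type*} (𝓗 : MeasurableSpace Ω) [mΩ : MeasurableSpace Ω]
    (Λ : Set (ProbabilityMeasure Ω)) (f g : Ω → ℝ) : Prop where
  le : 𝓗 ≤ mΩ
  measurable : Measurable[𝓗] g
  condExp_ae_eq : ∀ P ∈ Λ, (P : Measure Ω)[f | 𝓗] =ᵐ[(P : Measure Ω)] g

/-! The upper limit of the Birkhoff averages is defined at every point, without reference to a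
probability, and is invariant. Birkhoff's theorem, derived from the maximal inequality, makes it a
version of the conditional expectation under every invariant probability at once. For the upper
probability, the divergence set `A` is invariant and null for every invariant probability. Choose `P
∈ Λ` with `P A = V A`. Its Cesàro averages under `T` are dominated by the invariant `V`, which
compactness of `Λ` makes continuous at `∅`; hence an ultrafilter limit `Q` is σ-additive. `Q` is
invariant and equals `P` on invariant sets, so `V A = P A = Q A = 0`. -/

/-- Running maximum of the Birkhoff sums `0, S₁ φ, …, Sₙ φ`. -/
noncomputable def birkhoffMax {Ω : Type*} (T : Ω → Ω) (φ : Ω → ℝ) : ℕ → Ω → ℝ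
  | 0 => 0
  | n + 1 => fun x => max 0 (φ x + birkhoffMax T φ n (T x))

/-! ### Maximal ergodic inequality -/

section BirkhoffMax

variable {Ω : Type*} {T : Ω → Ω} {φ : Ω → ℝ}

theorem birkhoffMax_succ (n : ℕ) (x : Ω) :
    birkhoffMax T φ (n + 1) x = max 0 (φ x + birkhoffMax T φ n (T x)) := rfl

theorem birkhoffMax_nonneg (n : ℕ) (x : Ω) : 0 ≤ birkhoffMax T φ n x := by
  cases n with
  | zero => exact le_rfl
  | succ n => exact le_max_left _ _

theorem birkhoffMax_le_succ (n : ℕ) (x : Ω) :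
    birkhoffMax T φ n x ≤ birkhoffMax T φ (n + 1) x := by
  induction n generalizing x with
  | zero => exact birkhoffMax_nonneg 1 x
  | succ n ih =>
    rw [birkhoffMax_succ, birkhoffMax_succ]
    gcongr
    exact ih _

theorem birkhoffSum_le_birkhoffMax (n : ℕ) (x : Ω) :
    birkhoffSum T φ n x ≤ birkhoffMax T φ n x := by
  induction n generalizing x with
  | zero => simp [birkhoffMax]
  | succ n ih =>
    rw [birkhoffSum_succ', birkhoffMax_succ]
    exact le_max_of_le_right (by gcongr; exact ih _)

variable [MeasurableSpace Ω] {μ : Measure Ω}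

theorem measurable_birkhoffMax (hT : Measurable T) (hφ : Measurable φ) (n : ℕ) :
    Measurable (birkhoffMax T φ n) := by
  induction n with
  | zero => exact measurable_const
  | succ n ih => exact measurable_const.max (hφ.add (ih.comp hT))

theorem integrable_birkhoffMax (hT : MeasurePreserving T μ μ) (hφ : Integrable φ μ) (n : ℕ) :
    Integrable (birkhoffMax T φ n) μ := by
  induction n with
  | zero => exact integrable_zero _ _ _
  | succ n ih => exact (integrable_zero _ _ _).sup (hφ.add (hT.integrable_comp_of_integrable ih))

/-- The maximal ergodic inequality. -/
theorem setIntegral_birkhoffMax_pos_nonneg (hT : MeasurePreserving T μ μ) (hφm : Measurable φ)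
    (hφ : Integrable φ μ) (n : ℕ) : 0 ≤ ∫ x in {x | 0 < birkhoffMax T φ n x}, φ x ∂μ := by
  cases n with
  | zero => simp [birkhoffMax]
  | succ n =>
    set M := birkhoffMax T φ (n + 1) with hM
    have hMi : Integrable M μ := integrable_birkhoffMax hT hφ _
    have hMT : Integrable (M ∘ T) μ := hT.integrable_comp_of_integrable hMi
    have hs : MeasurableSet {x | 0 < M x} :=
      measurableSet_lt measurable_const (measurable_birkhoffMax hT.measurable hφm _)
    -- Where `M > 0` the maximum with `0` is inactive, and monotonicity in `n` gives `M ≤ φ + M ∘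
    -- T`.
    have h1 : ∫ x in {x | 0 < M x}, (M x - (M ∘ T) x) ∂μ ≤ ∫ x in {x | 0 < M x}, φ x ∂μ := by
      refine setIntegral_mono_on (hMi.sub hMT).integrableOn hφ.integrableOn hs fun x hx => ?_
      have hx' : M x = φ x + birkhoffMax T φ n (T x) := by
        have h : 0 < max 0 (φ x + birkhoffMax T φ n (T x)) := hx
        rw [hM, birkhoffMax_succ]
        exact max_eq_right (le_of_not_ge fun h' => by simp [max_eq_left h'] at h)
      have := birkhoffMax_le_succ (T := T) (φ := φ) n (T x)
      simp only [Function.comp_apply]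
      linarith
    refine le_trans ?_ h1
    rw [integral_sub hMi.integrableOn hMT.integrableOn, sub_nonneg]
    calc ∫ x in {x | 0 < M x}, (M ∘ T) x ∂μ ≤ ∫ x, (M ∘ T) x ∂μ :=
          setIntegral_le_integral hMT (ae_of_all _ fun x => birkhoffMax_nonneg _ _)
      _ = ∫ x, M x ∂μ := by
          have h := integral_map (μ := μ) hT.aemeasurable (f := M)
            (by rw [hT.map_eq]; exact hMi.aestronglyMeasurable)
          rw [hT.map_eq] at h
          exact h.symm
      _ = ∫ x in {x | 0 < M x}, M x ∂μ := by
          refine (setIntegral_eq_integral_of_forall_compl_eq_zero fun x hx => ?_).symm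
          exact le_antisymm (not_lt.1 hx) (birkhoffMax_nonneg _ _)

/-- If some Birkhoff sum of `φ` is positive at almost every point, then `φ` has nonnegative
integral. -/
theorem integral_nonneg_of_ae_exists_birkhoffSum_pos (hT : MeasurePreserving T μ μ)
    (hφm : Measurable φ) (hφ : Integrable φ μ) (h : ∀ᵐ x ∂μ, ∃ n, 0 < birkhoffSum T φ n x) :
    0 ≤ ∫ x, φ x ∂μ := by
  have hmono : Monotone fun n => {x | 0 < birkhoffMax T φ n x} :=
    monotone_nat_of_le_succ fun n x hx => lt_of_lt_of_le hx (birkhoffMax_le_succ n x)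
  have hlim := tendsto_setIntegral_of_monotone (μ := μ) (f := φ)
    (fun n => measurableSet_lt measurable_const (measurable_birkhoffMax hT.measurable hφm n))
    hmono hφ.integrableOn
  have huniv : (⋃ n, {x | 0 < birkhoffMax T φ n x}) =ᵐ[μ] Set.univ := by
    refine eventuallyEq_univ.2 (h.mono fun x hx => ?_)
    obtain ⟨n, hn⟩ := hx
    exact Set.mem_iUnion.2 ⟨n, hn.trans_le (birkhoffSum_le_birkhoffMax n x)⟩
  rw [setIntegral_congr_set huniv, setIntegral_univ] at hlim
  exact ge_of_tendsto' hlim (setIntegral_birkhoffMax_pos_nonneg hT hφm hφ)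

end BirkhoffMax

/-! ### Pointwise ergodic theorem for bounded functions -/

section PointwiseErgodic

variable {Ω : Type*} [MeasurableSpace Ω] {T : Ω → Ω} {f : Ω → ℝ}

theorem abs_birkhoffAverage_le {Ω : Type*} {T : Ω → Ω} {f : Ω → ℝ} {C : ℝ}
    (hC : ∀ ω, |f ω| ≤ C) (n : ℕ) (x : Ω) : |birkhoffAverage ℝ T f n x| ≤ C := by
  rcases n.eq_zero_or_pos with rfl | hn
  · simpa using (abs_nonneg _).trans (hC x)
  · have hn' : (0 : ℝ) < n := by exact_mod_cast hn
    have : |birkhoffSum T f n x| ≤ n * C := by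
      refine (Finset.abs_sum_le_sum_abs _ _).trans ((Finset.sum_le_sum fun i _ => hC _).trans ?_)
      simp
    rw [birkhoffAverage, smul_eq_mul, abs_mul, abs_of_pos (inv_pos.2 hn')]
    calc (n : ℝ)⁻¹ * |birkhoffSum T f n x| ≤ (n : ℝ)⁻¹ * (n * C) := by gcongr
      _ = C := by field_simp

theorem measurable_birkhoffAverage (hT : Measurable T) (hf : Measurable f) (n : ℕ) :
    Measurable (birkhoffAverage ℝ T f n) := by
  unfold birkhoffAverage birkhoffSum
  exact measurable_const.mul (Finset.measurable_sum _ fun i _ => hf.comp (hT.iterate i))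

theorem IsBoundedMeasurable.isBoundedUnder_le (hf : IsBoundedMeasurable f) (x : Ω) :
    IsBoundedUnder (· ≤ ·) atTop fun n => birkhoffAverage ℝ T f n x :=
  let ⟨C, hC⟩ := hf.2
  isBoundedUnder_of ⟨C, fun n => (abs_le.1 (abs_birkhoffAverage_le hC n x)).2⟩

theorem IsBoundedMeasurable.isBoundedUnder_ge (hf : IsBoundedMeasurable f) (x : Ω) :
    IsBoundedUnder (· ≥ ·) atTop fun n => birkhoffAverage ℝ T f n x :=
  let ⟨C, hC⟩ := hf.2
  isBoundedUnder_of ⟨-C, fun n => (abs_le.1 (abs_birkhoffAverage_le hC n x)).1⟩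

theorem IsBoundedMeasurable.neg (hf : IsBoundedMeasurable f) : IsBoundedMeasurable (-f) :=
  let ⟨C, hC⟩ := hf.2
  ⟨hf.1.neg, C, fun ω => by simpa using hC ω⟩

theorem IsBoundedMeasurable.integrable (hf : IsBoundedMeasurable f) (μ : Measure Ω)
    [IsFiniteMeasure μ] : Integrable f μ :=
  let ⟨C, hC⟩ := hf.2
  Integrable.of_bound hf.1.aestronglyMeasurable C (ae_of_all _ hC)

/-- The upper limit of the Birkhoff averages. -/
noncomputable def birkhoffLimsup (T : Ω → Ω) (f : Ω → ℝ) (x : Ω) : ℝ :=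
  limsup (fun n => birkhoffAverage ℝ T f n x) atTop

theorem isBoundedMeasurable_birkhoffLimsup (hT : Measurable T) (hf : IsBoundedMeasurable f) :
    IsBoundedMeasurable (birkhoffLimsup T f) := by
  obtain ⟨C, hC⟩ := hf.2
  refine ⟨Measurable.limsup fun n => measurable_birkhoffAverage hT hf.1 n, C, fun x => abs_le.2
    ⟨?_, ?_⟩⟩
  · exact le_limsup_of_frequently_le
      (Frequently.of_forall fun n => (abs_le.1 (abs_birkhoffAverage_le hC n x)).1)
      (hf.isBoundedUnder_le x)
  · exact limsup_le_of_le (hf.isBoundedUnder_ge x).isCoboundedUnder_le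
      (Eventually.of_forall fun n => (abs_le.1 (abs_birkhoffAverage_le hC n x)).2)

/-- The two sums differ only by `f (T^[n] x) - f x`, which is bounded. -/
theorem IsBoundedMeasurable.tendsto_birkhoffAverage_apply_map_sub (hf : IsBoundedMeasurable f)
    (x : Ω) : Tendsto (fun n => birkhoffAverage ℝ T f n (T x) - birkhoffAverage ℝ T f n x) atTop
      (𝓝 0) := by
  obtain ⟨C, hC⟩ := hf.2
  exact tendsto_birkhoffAverage_apply_sub_birkhoffAverage' ℝ (g := f)
    (isBounded_iff_forall_norm_le.2 ⟨C, by rintro _ ⟨y, rfl⟩; exact hC y⟩) T x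

theorem limsup_le_limsup_of_tendsto_sub_zero {u v : ℕ → ℝ}
    (hu : IsBoundedUnder (· ≥ ·) atTop u) (hv : IsBoundedUnder (· ≤ ·) atTop v)
    (h : Tendsto (fun n => u n - v n) atTop (𝓝 0)) : limsup u atTop ≤ limsup v atTop := by
  refine le_of_forall_pos_le_add fun ε hε => ?_
  refine limsup_le_of_le hu.isCoboundedUnder_le ?_
  filter_upwards [eventually_lt_of_limsup_lt (lt_add_of_pos_right (limsup v atTop) (half_pos hε)) hv,
    h.eventually_lt_const (half_pos hε)] with n h1 h2
  linarith

theorem birkhoffLimsup_apply_map (hf : IsBoundedMeasurable f) (x : Ω) :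
    birkhoffLimsup T f (T x) = birkhoffLimsup T f x := by
  have h0 := hf.tendsto_birkhoffAverage_apply_map_sub (T := T) x
  exact le_antisymm
    (limsup_le_limsup_of_tendsto_sub_zero (hf.isBoundedUnder_ge _) (hf.isBoundedUnder_le _) h0)
    (limsup_le_limsup_of_tendsto_sub_zero (hf.isBoundedUnder_ge _) (hf.isBoundedUnder_le _)
      (by simpa using h0.neg))

theorem measurable_invariants_birkhoffLimsup (hT : Measurable T) (hf : IsBoundedMeasurable f) :
    Measurable[MeasurableSpace.invariants T] (birkhoffLimsup T f) := by
  refine MeasurableSpace.measurable_invariants_dom.2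
    ⟨(isBoundedMeasurable_birkhoffLimsup hT hf).1, fun s _ => ?_⟩
  rw [show birkhoffLimsup T f ∘ T = birkhoffLimsup T f from
    funext fun x => birkhoffLimsup_apply_map hf x]

/-- On the invariant set `D` where the limsup exceeds `h + ε`, some Birkhoff sum of `f - h - ε` is
positive, so the maximal inequality for `P` restricted to `D` gives `ε P(D) ≤ ∫_D (f - h) = 0`. -/
theorem birkhoffLimsup_ae_le {P : Measure Ω} [IsProbabilityMeasure P]
    (hT : MeasurePreserving T P P) (hf : IsBoundedMeasurable f) {h : Ω → ℝ}
    (hh : Measurable[MeasurableSpace.invariants T] h)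
    (hhf : P[f | MeasurableSpace.invariants T] =ᵐ[P] h) : birkhoffLimsup T f ≤ᵐ[P] h := by
  have hle := MeasurableSpace.invariants_le T
  have hhi : Integrable h P := integrable_condExp.congr hhf
  have hfi := hf.integrable P
  have key (ε : ℝ) (hε : 0 < ε) : ∀ᵐ x ∂P, birkhoffLimsup T f x ≤ h x + ε := by
    set D := {x | h x + ε < birkhoffLimsup T f x} with hD
    have hDI : MeasurableSet[MeasurableSpace.invariants T] D :=
      measurableSet_lt (hh.add_const ε) (measurable_invariants_birkhoffLimsup hT.measurable hf)
    have hTD : MeasurePreserving T (P.restrict D) (P.restrict D) := by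
      have := hT.restrict_preimage (hle _ hDI)
      rwa [hDI.2] at this
    set φ : Ω → ℝ := f - fun x => h x + ε with hφ
    have hφi : Integrable φ (P.restrict D) :=
      (hfi.sub (hhi.add (integrable_const ε))).integrableOn
    have hinv : (fun x => h x + ε) ∘ T = fun x => h x + ε :=
      MeasurableSpace.comp_eq_of_measurable_invariants (hh.add_const ε)
    have hpos : 0 ≤ ∫ x in D, φ x ∂P := by
      refine integral_nonneg_of_ae_exists_birkhoffSum_pos hTD
        (hf.1.sub ((hh.mono hle le_rfl).add_const ε)) hφi ?_
      refine (ae_restrict_iff' (hle _ hDI)).2 (ae_of_all _ fun x hx => ?_)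
      -- Infinitely many averages exceed `h x + ε`, so one has `n > 0` and can be multiplied by `n`.
      obtain ⟨n, hn, hn0⟩ := ((frequently_lt_of_lt_limsup
        (hf.isBoundedUnder_ge x).isCoboundedUnder_le hx).and_eventually
          (eventually_gt_atTop 0)).exists
      have hn' : (0 : ℝ) < n := by exact_mod_cast hn0
      refine ⟨n, ?_⟩
      rw [hφ, birkhoffSum_sub, birkhoffSum_of_comp_eq hinv, Pi.smul_apply, sub_pos,
        nsmul_eq_mul]
      rwa [birkhoffAverage, smul_eq_mul, inv_mul_eq_div, lt_div_iff₀' hn'] at hn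
    have heq : ∫ x in D, f x ∂P = ∫ x in D, h x ∂P := by
      rw [← setIntegral_condExp hle hfi hDI]
      exact setIntegral_congr_ae (hle _ hDI) (hhf.mono fun x hx _ => hx)
    have hval : ∫ x in D, φ x ∂P = -(ε * P.real D) := by
      simp only [hφ, Pi.sub_apply]
      have hadd : Integrable (fun x => h x + ε) (P.restrict D) :=
        (hhi.add (integrable_const ε)).integrableOn
      rw [integral_sub hfi.integrableOn hadd,
        integral_add hhi.integrableOn (integrable_const ε).integrableOn, heq]
      simp [mul_comm]
    have hD0 : P.real D = 0 := by
      rw [hval] at hpos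
      nlinarith [measureReal_nonneg (μ := P) (s := D)]
    rw [ae_iff]
    simp only [not_le]
    exact (measureReal_eq_zero_iff).1 hD0
  have hall : ∀ᵐ x ∂P, ∀ k : ℕ, birkhoffLimsup T f x ≤ h x + 1 / ((k : ℝ) + 1) :=
    ae_all_iff.2 fun k => key _ (by positivity)
  filter_upwards [hall] with x hx
  have : Tendsto (fun k : ℕ => h x + 1 / ((k : ℝ) + 1)) atTop (𝓝 (h x + 0)) :=
    tendsto_const_nhds.add tendsto_one_div_add_atTop_nhds_zero_nat
  exact ge_of_tendsto' (by simpa using this) hx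

/-- The pointwise ergodic theorem for bounded functions. -/
theorem ae_tendsto_birkhoffAverage {P : Measure Ω} [IsProbabilityMeasure P]
    (hT : MeasurePreserving T P P) (hf : IsBoundedMeasurable f) {h : Ω → ℝ}
    (hh : Measurable[MeasurableSpace.invariants T] h)
    (hhf : P[f | MeasurableSpace.invariants T] =ᵐ[P] h) :
    ∀ᵐ x ∂P, Tendsto (fun n => birkhoffAverage ℝ T f n x) atTop (𝓝 (h x)) := by
  have hneg : P[-f | MeasurableSpace.invariants T] =ᵐ[P] -h :=
    (condExp_neg f _).trans hhf.neg
  filter_upwards [birkhoffLimsup_ae_le hT hf hh hhf,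
    birkhoffLimsup_ae_le hT hf.neg hh.neg hneg] with x h1 h2
  -- The bound for `-f` controls the lower limit.
  refine tendsto_order.2 ⟨fun a ha => ?_, fun a ha => ?_⟩
  · have := eventually_lt_of_limsup_lt
      (show birkhoffLimsup T (-f) x < -a from h2.trans_lt (neg_lt_neg ha))
      (hf.neg.isBoundedUnder_le x)
    refine this.mono fun n hn => ?_
    rw [birkhoffAverage_neg] at hn
    exact neg_lt_neg_iff.1 hn
  · exact eventually_lt_of_limsup_lt (lt_of_le_of_lt h1 ha) (hf.isBoundedUnder_le x)

theorem isCommonCondExp_birkhoffLimsup (hT : Measurable T) (hf : IsBoundedMeasurable f) :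
    IsCommonCondExp (MeasurableSpace.invariants T) (invariantProbabilities T) f
      (birkhoffLimsup T f) where
  le := MeasurableSpace.invariants_le T
  measurable := measurable_invariants_birkhoffLimsup hT hf
  condExp_ae_eq P hP := by
    filter_upwards [ae_tendsto_birkhoffAverage hP hf stronglyMeasurable_condExp.measurable
      EventuallyEq.rfl] with x hx
    exact hx.limsup_eq.symm

end PointwiseErgodic

/-! ### Invariant probabilities below an invariant upper probability -/

section InvariantUpperProbability

variable {Ω : Type*} [MeasurableSpace Ω]

/-- A limit along an ultrafilter of probability measures that are dominated by a set function
continuous at `∅` is again a probability measure. -/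
theorem exists_isProbabilityMeasure_tendsto {ι : Type*} (U : Ultrafilter ι) (μ : ι → Measure Ω)
    [∀ i, IsProbabilityMeasure (μ i)] (W : Set Ω → ENNReal)
    (hμW : ∀ i A, MeasurableSet A → μ i A ≤ W A)
    (hW : ∀ s : ℕ → Set Ω, (∀ n, MeasurableSet (s n)) → Antitone s → ⋂ n, s n = ∅ →
      Tendsto (fun n => W (s n)) atTop (𝓝 0)) :
    ∃ Q : Measure Ω, IsProbabilityMeasure Q ∧
      ∀ A, MeasurableSet A → Tendsto (fun i => μ i A) U (𝓝 (Q A)) := by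
  have hex (A : Set Ω) : ∃ a, Tendsto (fun i => μ i A) U (𝓝 a) :=
    ⟨_, (U.map fun i => μ i A).le_nhds_lim⟩
  -- Ultrafilter limits exist in the compact space `[0, ∞]`; finite additivity passes to the limit,
  -- and domination by `W` supplies continuity at `∅`, hence σ-additivity.
  choose m hm using hex
  have hring : IsSetRing {A : Set Ω | MeasurableSet A} :=
    ⟨MeasurableSet.empty, fun _ _ hs ht => hs.union ht, fun _ _ hs ht => hs.diff ht⟩
  have hempty : m ∅ = 0 := tendsto_nhds_unique (hm ∅) (by simp)
  let c : AddContent ENNReal {A : Set Ω | MeasurableSet A} :=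
    hring.addContent_of_union m hempty fun {s t} _ ht hst =>
      tendsto_nhds_unique (hm _) (((hm s).add (hm t)).congr fun i => (measure_union hst ht).symm)
  have hle1 (A : Set Ω) : m A ≤ 1 := le_of_tendsto' (hm A) fun i => prob_le_one
  let Q : Measure Ω := Measure.ofMeasurable (fun A _ => m A) hempty fun s hs hd =>
    addContent_iUnion_eq_sum_of_tendsto_zero hring c
      (fun A _ => ((hle1 A).trans_lt ENNReal.one_lt_top).ne)
      (fun t ht hanti hcap => tendsto_of_tendsto_of_tendsto_of_le_of_le tendsto_const_nhds
        (hW t ht hanti hcap) (fun _ => zero_le)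
        fun n => le_of_tendsto' (hm (t n)) fun i => hμW i _ (ht n))
      hs (MeasurableSet.iUnion hs) hd
  have hQ (A : Set Ω) (hA : MeasurableSet A) : Q A = m A := Measure.ofMeasurable_apply A hA
  refine ⟨Q, ⟨?_⟩, fun A hA => by rw [hQ A hA]; exact hm A⟩
  rw [hQ _ MeasurableSet.univ]
  exact tendsto_nhds_unique (hm _) (by simp)

/-- An upper probability is continuous at `∅`. -/
theorem IsUpperProbability.tendsto_zero {V : Set Ω → ℝ} (hV : IsUpperProbability V)
    {s : ℕ → Set Ω} (hs : ∀ n, MeasurableSet (s n)) (hanti : Antitone s)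
    (hcap : ⋂ n, s n = ∅) : Tendsto (fun n => V (s n)) atTop (𝓝 0) := by
  obtain ⟨hcapV, Λ, hΛ, hmax⟩ := hV
  have hVanti : Antitone fun n => V (s n) := fun m n hmn => hcapV.mono _ _ (hs n) (hs m) (hanti hmn)
  have hV0 (n : ℕ) : 0 ≤ V (s n) := by
    rw [← hcapV.empty]; exact hcapV.mono _ _ MeasurableSet.empty (hs n) (Set.empty_subset _)
  refine tendsto_order.2 ⟨fun a ha => Eventually.of_forall fun n => ha.trans_le (hV0 n),
    fun ε hε => ?_⟩
  by_contra hcon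
  have hge (n : ℕ) : ε ≤ V (s n) := by
    by_contra hn
    exact hcon (eventually_atTop.2 ⟨n, fun k hk => (hVanti hk).trans_lt (not_le.1 hn)⟩)
  let : TopologicalSpace (ProbabilityMeasure Ω) := setwiseTopology Ω
  have hcont (n : ℕ) : Continuous fun P : ProbabilityMeasure Ω => (P : Measure Ω).real (s n) :=
    (continuous_apply (⟨s n, hs n⟩ : {A : Set Ω // MeasurableSet A})).comp
      (continuous_induced_dom (f := fun (P : ProbabilityMeasure Ω)
        (A : {A : Set Ω // MeasurableSet A}) => (P : Measure Ω).real A.1))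
  -- If `V (s n) ≥ ε` for all `n`, the maximizers give the finite intersection property, so a single
  -- `P` satisfies `P (s n) ≥ ε` for all `n`, against its own continuity at `∅`.
  obtain ⟨P, -, hP⟩ := hΛ.inter_iInter_nonempty
    (fun n => {P : ProbabilityMeasure Ω | ε ≤ (P : Measure Ω).real (s n)})
    (fun n => isClosed_le continuous_const (hcont n)) fun u => by
      obtain ⟨N, hN⟩ := u.exists_le
      obtain ⟨P, hPΛ, hP⟩ := (hmax _ (hs N)).1
      refine ⟨P, hPΛ, Set.mem_iInter₂.2 fun n hn => ?_⟩
      exact (hge N).trans (hP.symm.le.trans (measureReal_mono (hanti (hN n hn))))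
  have hlim : Tendsto (fun n => (P : Measure Ω) (s n)) atTop (𝓝 0) := by
    have := tendsto_measure_iInter_atTop (μ := (P : Measure Ω))
      (fun n => (hs n).nullMeasurableSet) hanti ⟨0, measure_ne_top _ _⟩
    rwa [hcap, measure_empty] at this
  have hlim' : Tendsto (fun n => (P : Measure Ω).real (s n)) atTop (𝓝 0) := by
    simpa [Measure.real, Function.comp_def] using
      (ENNReal.tendsto_toReal ENNReal.zero_ne_top).comp hlim
  exact absurd (ge_of_tendsto' hlim' fun n => Set.mem_iInter.1 hP n) (not_le.2 hε)

/-- The Cesàro average of the first `n + 1` images of `P` under the iterates of `T`. -/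
noncomputable def cesaroMeasure (T : Ω → Ω) (P : Measure Ω) (n : ℕ) : Measure Ω :=
  ((n : ENNReal) + 1)⁻¹ • ∑ i ∈ Finset.range (n + 1), P.map T^[i]

variable {T : Ω → Ω} {P : Measure Ω}

theorem cesaroMeasure_apply (hT : Measurable T) (n : ℕ) {A : Set Ω} (hA : MeasurableSet A) :
    cesaroMeasure T P n A
      = ((n : ENNReal) + 1)⁻¹ * ∑ i ∈ Finset.range (n + 1), P (T^[i] ⁻¹' A) := by
  simp only [cesaroMeasure, Measure.smul_apply, Measure.finsetSum_apply, smul_eq_mul]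
  congr 1
  exact Finset.sum_congr rfl fun i _ => Measure.map_apply (hT.iterate i) hA

theorem cesaroMeasure_apply_le (hT : Measurable T) (n : ℕ) {A : Set Ω} (hA : MeasurableSet A)
    {c : ENNReal} (hc : ∀ i, P (T^[i] ⁻¹' A) ≤ c) : cesaroMeasure T P n A ≤ c := by
  rw [cesaroMeasure_apply hT n hA]
  calc _ ≤ ((n : ENNReal) + 1)⁻¹ * ∑ i ∈ Finset.range (n + 1), c := by gcongr; exact hc _
    _ = c := by
      rw [Finset.sum_const, Finset.card_range, nsmul_eq_mul, ← mul_assoc, Nat.cast_add,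
        Nat.cast_one, ENNReal.inv_mul_cancel (by simp) (by finiteness), one_mul]

theorem cesaroMeasure_apply_eq (hT : Measurable T) (n : ℕ) {A : Set Ω} (hA : MeasurableSet A)
    {c : ENNReal} (hc : ∀ i, P (T^[i] ⁻¹' A) = c) : cesaroMeasure T P n A = c := by
  rw [cesaroMeasure_apply hT n hA, Finset.sum_congr rfl fun i _ => hc i, Finset.sum_const,
    Finset.card_range, nsmul_eq_mul, ← mul_assoc, Nat.cast_add, Nat.cast_one,
    ENNReal.inv_mul_cancel (by simp) (by finiteness), one_mul]

/-- Pulling back by `T` shifts the indices by one, so the only new term is `i = n + 1`, of mass at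
most `1`. -/
theorem cesaroMeasure_preimage_le [IsProbabilityMeasure P] (hT : Measurable T) (n : ℕ)
    {A : Set Ω} (hA : MeasurableSet A) :
    cesaroMeasure T P n (T ⁻¹' A) ≤ cesaroMeasure T P n A + ((n : ENNReal) + 1)⁻¹ := by
  rw [cesaroMeasure_apply hT n hA, cesaroMeasure_apply hT n (hT hA),
    ← mul_add_one]
  gcongr
  have hshift (i : ℕ) : T^[i] ⁻¹' (T ⁻¹' A) = T^[i + 1] ⁻¹' A := by
    rw [← Set.preimage_comp, ← Function.iterate_succ']
  simp only [hshift]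
  calc ∑ i ∈ Finset.range (n + 1), P (T^[i + 1] ⁻¹' A)
      ≤ ∑ i ∈ Finset.range (n + 1 + 1), P (T^[i] ⁻¹' A) := by
        rw [Finset.sum_range_succ' _ (n + 1)]; exact le_self_add
    _ ≤ _ := by rw [Finset.sum_range_succ _ (n + 1)]; gcongr; exact prob_le_one

theorem isProbabilityMeasure_cesaroMeasure [IsProbabilityMeasure P] (hT : Measurable T) (n : ℕ) :
    IsProbabilityMeasure (cesaroMeasure T P n) :=
  ⟨cesaroMeasure_apply_eq hT n MeasurableSet.univ fun i => by simp⟩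

/-- A probability dominated by an invariant upper probability agrees on invariant sets with some
invariant probability. -/
theorem exists_measurePreserving_eq_on_invariants [IsProbabilityMeasure P] (hT : Measurable T)
    {V : Set Ω → ℝ} (hV : IsUpperProbability V) (hVT : IsInvariantCapacity T V)
    (hPV : ∀ A, MeasurableSet A → P.real A ≤ V A) :
    ∃ Q : Measure Ω, IsProbabilityMeasure Q ∧ MeasurePreserving T Q Q ∧
      ∀ A, MeasurableSet[MeasurableSpace.invariants T] A → Q A = P A := by
  have hVi (i : ℕ) (A : Set Ω) (hA : MeasurableSet A) : V (T^[i] ⁻¹' A) = V A := by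
    induction i with
    | zero => rfl
    | succ i ih =>
      rw [Function.iterate_succ, Set.preimage_comp, hVT _ (hT.iterate i hA), ih]
  have hprob := isProbabilityMeasure_cesaroMeasure (P := P) hT
  obtain ⟨Q, hQ, hlim⟩ := exists_isProbabilityMeasure_tendsto (Ultrafilter.of atTop)
    (cesaroMeasure T P) (fun A => ENNReal.ofReal (V A))
    (fun n A hA => cesaroMeasure_apply_le hT n hA fun i => by
      rw [← hVi i A hA, ← ofReal_measureReal]
      exact ENNReal.ofReal_le_ofReal (hPV _ (hT.iterate i hA)))
    (fun s hs hanti hcap => by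
      simpa using ENNReal.tendsto_ofReal (hV.tendsto_zero hs hanti hcap))
  refine ⟨Q, hQ, ⟨hT, ?_⟩, fun A hA => ?_⟩
  · have := Measure.isProbabilityMeasure_map (μ := Q) hT.aemeasurable
    -- Both measures have total mass `1`, so the one-sided Cesàro estimate suffices.
    refine Measure.eq_of_le_of_isProbabilityMeasure (Measure.le_iff.2 fun A hA => ?_)
    rw [Measure.map_apply hT hA]
    have h0 : Tendsto (fun n : ℕ => ((n : ENNReal) + 1)⁻¹)
        ((Ultrafilter.of atTop : Ultrafilter ℕ) : Filter ℕ) (𝓝 0) := by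
      have := (tendsto_add_atTop_iff_nat 1).2 ENNReal.tendsto_inv_nat_nhds_zero
      exact (by simpa using this : Tendsto (fun n : ℕ => ((n : ENNReal) + 1)⁻¹) atTop (𝓝 0)).mono_left
        (Ultrafilter.of_le _)
    simpa using le_of_tendsto_of_tendsto' (hlim _ (hT hA)) ((hlim A hA).add h0)
      fun n => cesaroMeasure_preimage_le hT n hA
  · refine tendsto_nhds_unique (hlim A hA.1) (tendsto_const_nhds.congr fun n => ?_)
    refine (cesaroMeasure_apply_eq hT n hA.1 fun i => ?_).symm
    exact congrArg P (MeasurableSpace.le_invariants_iterate T i A hA).2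

/-- An invariant upper probability vanishes on every invariant set which is null for all invariant
probabilities. -/
theorem IsUpperProbability.eq_zero_of_invariants (hT : Measurable T)
    {V : Set Ω → ℝ} (hV : IsUpperProbability V) (hVT : IsInvariantCapacity T V) {A : Set Ω}
    (hA : MeasurableSet[MeasurableSpace.invariants T] A)
    (hnull : ∀ Q ∈ invariantProbabilities T, (Q : Measure Ω) A = 0) : V A = 0 := by
  obtain ⟨-, Λ, -, hmax⟩ := id hV
  obtain ⟨P, hPΛ, hP⟩ := (hmax A hA.1).1
  obtain ⟨Q, hQ, hQT, hQP⟩ := exists_measurePreserving_eq_on_invariants (P := (P : Measure Ω)) hT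
    hV hVT fun B hB => (hmax B hB).2 ⟨P, hPΛ, rfl⟩
  have h0 : Q A = 0 := hnull ⟨Q, hQ⟩ hQT
  rw [← hP]
  simp [Measure.real, ← hQP A hA, h0]

end InvariantUpperProbability

/-! ### Invariance of the convergence set and conclusion -/

theorem tendsto_birkhoffAverage_apply_map_iff {Ω : Type*} [MeasurableSpace Ω] {T : Ω → Ω}
    {f : Ω → ℝ} (hf : IsBoundedMeasurable f) (x : Ω) (a : ℝ) :
    Tendsto (fun n => birkhoffAverage ℝ T f n (T x)) atTop (𝓝 a) ↔
      Tendsto (fun n => birkhoffAverage ℝ T f n x) atTop (𝓝 a) := by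
  have h0 := hf.tendsto_birkhoffAverage_apply_map_sub (T := T) x
  exact ⟨fun h => by simpa using h.sub h0, fun h => by simpa using h.add h0⟩

theorem theorem3p1 {Ω : Type*} [MeasurableSpace Ω] [StandardBorelSpace Ω]
    (T : Ω → Ω) (hT : Measurable T) (f : Ω → ℝ) (hf : IsBoundedMeasurable f) :
    (∃ g : Ω → ℝ, IsBoundedMeasurable g ∧
      IsCommonCondExp (MeasurableSpace.invariants T) (invariantProbabilities T) f g) ∧
    ∀ g : Ω → ℝ,
      IsCommonCondExp (MeasurableSpace.invariants T) (invariantProbabilities T) f g →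
      ∀ V : Set Ω → ℝ, IsUpperProbability V → IsInvariantCapacity T V →
        MeasurableSet
          {ω : Ω | Tendsto (fun n : ℕ => birkhoffAverage ℝ T f n ω) atTop (𝓝 (g ω))} ∧
        V {ω : Ω | Tendsto (fun n : ℕ => birkhoffAverage ℝ T f n ω) atTop (𝓝 (g ω))}ᶜ = 0 := by
  refine ⟨⟨birkhoffLimsup T f, isBoundedMeasurable_birkhoffLimsup hT hf,
    isCommonCondExp_birkhoffLimsup hT hf⟩, fun g hg V hV hVT => ?_⟩
  have hgT : g ∘ T = g := MeasurableSpace.comp_eq_of_measurable_invariants hg.measurable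
  set B := {ω : Ω | Tendsto (fun n : ℕ => birkhoffAverage ℝ T f n ω) atTop (𝓝 (g ω))} with hB
  have hBm : MeasurableSet B := measurableSet_tendsto_fun
    (fun n => measurable_birkhoffAverage hT hf.1 n) (hg.measurable.mono hg.le le_rfl)
  have hBI : MeasurableSet[MeasurableSpace.invariants T] B := by
    refine ⟨hBm, Set.ext fun x => ?_⟩
    have := tendsto_birkhoffAverage_apply_map_iff (T := T) hf x (g x)
    simpa only [hB, Set.mem_preimage, Set.mem_ofPred_eq, show g (T x) = g x from congrFun hgT x]
  exact ⟨hBm, hV.eq_zero_of_invariants hT hVT hBI.compl fun Q hQ =>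
    ae_tendsto_birkhoffAverage hQ hf hg.measurable (hg.condExp_ae_eq Q hQ)⟩
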